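/- Let $\nu>-1$ and $\theta>1$ be real, and for $k\in\{0,1,2,\dots\}$ let $$\mathrm{L}_k^{\nu}(z)=\sum_{i=0}^{k}(-1)^i\binom{k+\nu}{k-i}\frac{z^i}{i!}$$ be the Laguerre polynomials in standard normalization. Let $K_\nu$ be the modified Bessel function of the second kind (Macdonald function), $K_\nu(x)=\int_0^\infty e^{-x\cosh t}\cosh(\nu t)\,dt$ for $x>0$, and let $d\sigma$ be Lebesgue area measure on $\mathbb{C}$. Then for all integers $k,m\ge 0$ the following integral converges absolutely and $$\frac{2\theta^{-\nu/2}}{\pi(\theta-1)}\int_{\mathbb{C}}\mathrm{L}_k^{\nu}(z)\,\overline{\mathrm{L}_m^{\nu}(z)}\,\exp\!\left(\frac{2\,\mathrm{Re}\,z}{\theta-1}\right)|z|^{\nu}K_{\nu}\!\left(\frac{2\sqrt{\theta}\,|z|}{\theta-1}\right)d\sigma=\delta_{k,m}\,\frac{\Gamma(k+\nu+1)\,\theta^k}{k!},$$ where $\delta_{k,m}=1$ if $k=m$ and $\delta_{k,m}=0$ otherwise. -/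

import Mathlib

/-- The standardly normalized (generalized) Laguerre polynomial
`L_k^ν(X) = ∑_{i=0}^{k} (-1)^i * binom(k + ν, k - i) * X^i / i!`,
where `binom(k + ν, k - i) = (k + ν)(k + ν - 1) ⋯ (i + 1 + ν) / (k - i)!` is the generalized
binomial coefficient with real upper argument. -/
noncomputable def laguerrePoly (ν : ℝ) (k : ℕ) : Polynomial ℝ :=
  ∑ i ∈ Finset.range (k + 1),
    Polynomial.monomial i ((-1) ^ i * Ring.choose ((k : ℝ) + ν) (k - i) / (i.factorial : ℝ))

/-- The modified Bessel function of the second kind (Macdonald function) of real order `ν`,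
`K_ν(x) = ∫_0^∞ exp(-x cosh t) cosh(ν t) dt` for `x > 0`.
The integral converges absolutely for every real `ν` and every `x > 0`. -/
noncomputable def macdonaldK (ν x : ℝ) : ℝ :=
  ∫ t in Set.Ioi (0 : ℝ), Real.exp (-x * Real.cosh t) * Real.cosh (ν * t)

/-- The weight `exp(2 Re z / (θ - 1)) |z|^ν K_ν(2 √θ |z| / (θ - 1))` on the complex plane. -/
noncomputable def laguerreWeight (ν θ : ℝ) (z : ℂ) : ℝ :=
  Real.exp (2 * z.re / (θ - 1)) * ‖z‖ ^ ν * macdonaldK ν (2 * Real.sqrt θ * ‖z‖ / (θ - 1))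

/-! The weight is, up to the factor `θ ^ (ν / 2) / 2`, a mixture over `u > 0`, with mass `u ^ (ν -
1) * exp (-u)`, of the Gaussians `exp (-‖z - u‖ ^ 2 / ((θ - 1) * u))`: completing the exponent turns
the `u`-integral into the Macdonald integral (`mul_exp_mul_laguerreKernel`). By Fubini the plane
integral can be done first, for fixed `u`. Monomials centred at `u` are orthogonal for a
rotation-invariant Gaussian, so only products of equal-order Taylor coefficients at `u` survive
(`Complex.integral_aeval_mul_conj_aeval_mul_exp_neg_sub`). The `n`-th one comes with weight `u ^ (ν
+ n) * exp (-u)`, and the `n`-th derivative of a Laguerre polynomial is, up to a constant, a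
Laguerre polynomial with parameter `ν + n`, so classical half-line orthogonality applies to every
term. The diagonal terms add up to `((θ - 1) + 1) ^ k`. -/

/-! ### Coefficients and derivatives of Laguerre polynomials -/

theorem Real.Gamma_add_natCast_eq_mul_ascPochhammer {x : ℝ} (hx : 0 < x) (n : ℕ) :
    Real.Gamma (x + n) = Real.Gamma x * (ascPochhammer ℝ n).eval x := by
  induction n with
  | zero => simp
  | succ n ih =>
    have h : x + (n : ℝ) ≠ 0 := by positivity
    rw [Nat.cast_succ, ← add_assoc, Real.Gamma_add_one h, ih, ascPochhammer_succ_eval]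
    ring

theorem Real.ringChoose_eq_Gamma_div {x : ℝ} (hx : 0 < x) (n : ℕ) :
    Ring.choose (x + n - 1) n = Real.Gamma (x + n) / (n.factorial * Real.Gamma x) := by
  have h := Ring.factorial_nsmul_multichoose_eq_ascPochhammer x n
  rw [Ring.multichoose_eq, nsmul_eq_mul, Polynomial.ascPochhammer_smeval_cast,
    Polynomial.ascPochhammer_smeval_eq_eval] at h
  have hΓ := (Real.Gamma_pos_of_pos hx).ne'
  have hn : (n.factorial : ℝ) ≠ 0 := by positivity
  rw [Real.Gamma_add_natCast_eq_mul_ascPochhammer hx, ← h]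
  field_simp

theorem laguerrePoly_coeff_of_le (ν : ℝ) {k i : ℕ} (h : i ≤ k) :
    (laguerrePoly ν k).coeff i =
      (-1) ^ i * Ring.choose ((k : ℝ) + ν) (k - i) / (i.factorial : ℝ) := by
  simp only [laguerrePoly, Polynomial.finsetSum_coeff, Polynomial.coeff_monomial]
  rw [Finset.sum_ite_eq' (Finset.range (k + 1)) i, if_pos (by simp; omega)]

theorem laguerrePoly_coeff_of_lt (ν : ℝ) {k i : ℕ} (h : k < i) :
    (laguerrePoly ν k).coeff i = 0 := by
  simp only [laguerrePoly, Polynomial.finsetSum_coeff, Polynomial.coeff_monomial]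
  rw [Finset.sum_ite_eq' (Finset.range (k + 1)) i, if_neg (by simp; omega)]

theorem laguerrePoly_natDegree_lt (ν : ℝ) (k : ℕ) : (laguerrePoly ν k).natDegree < k + 1 :=
  Nat.lt_succ_of_le <| Polynomial.natDegree_le_iff_coeff_eq_zero.2
    fun _ h => laguerrePoly_coeff_of_lt ν h

/-- The upper binomial argument is unchanged, since `(k - n) + (ν + n) = k + ν`; only factorials
need comparing. -/
theorem hasseDeriv_laguerrePoly (ν : ℝ) {k n : ℕ} (h : n ≤ k) :
    Polynomial.hasseDeriv n (laguerrePoly ν k) =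
      Polynomial.C ((-1) ^ n / (n.factorial : ℝ)) * laguerrePoly (ν + n) (k - n) := by
  ext i
  rw [Polynomial.hasseDeriv_coeff, Polynomial.coeff_C_mul]
  by_cases hi : i + n ≤ k
  · rw [laguerrePoly_coeff_of_le ν hi, laguerrePoly_coeff_of_le _ (by omega : i ≤ k - n),
      Nat.cast_sub h, show k - (i + n) = k - n - i by omega,
      show (k : ℝ) - n + (ν + n) = k + ν by ring]
    have hc : (((i + n).choose n : ℕ) : ℝ) * (i.factorial * n.factorial) = (i + n).factorial := by
      rw [← Nat.add_choose_mul_factorial_mul_factorial i n, ← Nat.choose_symm_add]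
      push_cast; ring
    have h1 : (i.factorial : ℝ) ≠ 0 := by positivity
    have h2 : (n.factorial : ℝ) ≠ 0 := by positivity
    have h3 : (((i + n).choose n : ℕ) : ℝ) ≠ 0 := by
      have := Nat.choose_pos (Nat.le_add_left n i)
      positivity
    rw [← hc]
    field_simp
    ring
  · rw [laguerrePoly_coeff_of_lt ν (by omega), laguerrePoly_coeff_of_lt _ (by omega)]
    simp

/-! ### Orthogonality on the half-line -/

/-- The sum is, up to sign, a `k`-th finite difference, which kills degree below `k` and sees only
the leading coefficient in degree `k`. -/
theorem Polynomial.sum_neg_one_pow_mul_choose_mul_eval (p : Polynomial ℝ) (k : ℕ) (y : ℝ)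
    (hp : p.natDegree ≤ k) :
    ∑ i ∈ Finset.range (k + 1), (-1) ^ i * (k.choose i : ℝ) * p.eval (y + i) =
      (-1) ^ k * k.factorial * p.coeff k := by
  have h1 : ∑ i ∈ Finset.range (k + 1), (-1) ^ i * (k.choose i : ℝ) * p.eval (y + i) =
      (-1) ^ k * (fwdDiff 1)^[k] p.eval y := by
    rw [fwdDiff_iter_eq_sum_shift, Finset.mul_sum]
    refine Finset.sum_congr rfl fun i hi => ?_
    obtain ⟨j, rfl⟩ := Nat.exists_eq_add_of_le (Nat.lt_succ_iff.1 (Finset.mem_range.1 hi))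
    have : ((-1 : ℝ) ^ j) * (-1) ^ j = 1 := by rw [← mul_pow]; simp
    simp only [Nat.add_sub_cancel_left, zsmul_eq_mul, nsmul_eq_mul, mul_one]
    push_cast
    rw [pow_add]
    linear_combination (-(-1) ^ i * ((i + j).choose i : ℝ) * p.eval (y + i)) * this
  rw [h1]
  rcases hp.lt_or_eq with h | rfl
  · rw [Polynomial.fwdDiff_iter_eq_zero_of_degree_lt h, p.coeff_eq_zero_of_natDegree_lt h]
    simp
  · rw [Polynomial.fwdDiff_iter_degree_eq_factorial]
    simp only [Pi.smul_apply, Pi.natCast_apply, smul_eq_mul, leadingCoeff]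
    ring

open MeasureTheory Set

theorem integrableOn_eval_mul_rpow_mul_exp_neg (p : Polynomial ℝ) {μ : ℝ} (hμ : -1 < μ) :
    IntegrableOn (fun u : ℝ => p.eval u * (u ^ μ * Real.exp (-u))) (Ioi 0) := by
  simp_rw [p.eval_eq_sum_range, Finset.sum_mul]
  refine integrable_finsetSum _ fun j _ => ?_
  have h := (Real.GammaIntegral_convergent
    (show 0 < μ + j + 1 by have := j.cast_nonneg (α := ℝ); linarith)).const_mul (p.coeff j)
  refine IntegrableOn.congr_fun h (fun u hu => ?_) measurableSet_Ioi
  rw [show μ + j + 1 - 1 = μ + j by ring, Real.rpow_add_natCast (ne_of_gt hu)]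
  ring

theorem integral_pow_mul_rpow_mul_exp_neg {μ : ℝ} (hμ : -1 < μ) (j : ℕ) :
    ∫ u in Ioi (0 : ℝ), u ^ j * (u ^ μ * Real.exp (-u)) = Real.Gamma (μ + j + 1) := by
  rw [Real.Gamma_eq_integral (by have := j.cast_nonneg (α := ℝ); linarith)]
  refine setIntegral_congr_fun measurableSet_Ioi fun u hu => ?_
  rw [show μ + j + 1 - 1 = μ + j by ring, Real.rpow_add_natCast (ne_of_gt hu)]
  ring

theorem integral_eval_mul_rpow_mul_exp_neg (p : Polynomial ℝ) {μ : ℝ} (hμ : -1 < μ) {N : ℕ}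
    (hN : p.natDegree < N) :
    ∫ u in Ioi (0 : ℝ), p.eval u * (u ^ μ * Real.exp (-u)) =
      ∑ j ∈ Finset.range N, p.coeff j * Real.Gamma (μ + j + 1) := by
  simp_rw [Polynomial.eval_eq_sum_range' hN, Finset.sum_mul]
  rw [integral_finsetSum]
  · refine Finset.sum_congr rfl fun j _ => ?_
    simp_rw [mul_assoc]
    rw [integral_const_mul, integral_pow_mul_rpow_mul_exp_neg hμ]
  · intro j _
    simpa [IntegrableOn] using integrableOn_eval_mul_rpow_mul_exp_neg (Polynomial.monomial j (p.coeff j)) hμ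

/-- Integrated termwise, the `i`-th term contains `Γ(μ + 1 + i + j) / Γ(μ + 1 + i)`, a monic
polynomial of degree `j` in `i`, so the sum is a `k`-th difference of it. -/
theorem integral_pow_mul_laguerrePoly {μ : ℝ} (hμ : -1 < μ) {j k : ℕ} (hj : j ≤ k) :
    ∫ u in Ioi (0 : ℝ), u ^ j * (laguerrePoly μ k).eval u * (u ^ μ * Real.exp (-u)) =
      if j = k then (-1) ^ k * Real.Gamma (k + μ + 1) else 0 := by
  have hμj : -1 < μ + j := by have := j.cast_nonneg (α := ℝ); linarith
  have h1 : ∫ u in Ioi (0 : ℝ), u ^ j * (laguerrePoly μ k).eval u * (u ^ μ * Real.exp (-u)) =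
      ∫ u in Ioi (0 : ℝ), (laguerrePoly μ k).eval u * (u ^ (μ + j) * Real.exp (-u)) := by
    refine setIntegral_congr_fun measurableSet_Ioi fun u hu => ?_
    rw [Real.rpow_add_natCast (ne_of_gt hu)]
    ring
  rw [h1, integral_eval_mul_rpow_mul_exp_neg _ hμj (laguerrePoly_natDegree_lt μ k)]
  have h2 := Polynomial.sum_neg_one_pow_mul_choose_mul_eval (ascPochhammer ℝ j) k (μ + 1)
    (by rwa [ascPochhammer_natDegree])
  have h3 : (ascPochhammer ℝ j).coeff k = if j = k then 1 else 0 := by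
    split_ifs with h
    · subst h
      have := monic_ascPochhammer ℝ j
      rwa [Polynomial.Monic, Polynomial.leadingCoeff, ascPochhammer_natDegree] at this
    · exact Polynomial.coeff_eq_zero_of_natDegree_lt (by rw [ascPochhammer_natDegree]; omega)
  have hk : (k.factorial : ℝ) ≠ 0 := by positivity
  have h4 : ∑ i ∈ Finset.range (k + 1), (laguerrePoly μ k).coeff i * Real.Gamma (μ + j + i + 1) =
      Real.Gamma (k + μ + 1) / k.factorial * ∑ i ∈ Finset.range (k + 1),
        (-1) ^ i * (k.choose i : ℝ) * (ascPochhammer ℝ j).eval (μ + 1 + i) := by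
    rw [Finset.mul_sum]
    refine Finset.sum_congr rfl fun i hi => ?_
    have hik : i ≤ k := Nat.lt_succ_iff.1 (Finset.mem_range.1 hi)
    have hpos : 0 < μ + 1 + i := by have := i.cast_nonneg (α := ℝ); linarith
    have hc := Real.ringChoose_eq_Gamma_div hpos (k - i)
    rw [Nat.cast_sub hik, show μ + 1 + i + ((k : ℝ) - i) - 1 = k + μ by ring,
      show μ + 1 + i + ((k : ℝ) - i) = k + μ + 1 by ring] at hc
    have hΓ := (Real.Gamma_pos_of_pos hpos).ne'
    have hi1 : (i.factorial : ℝ) ≠ 0 := by positivity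
    have hi2 : ((k - i).factorial : ℝ) ≠ 0 := by positivity
    rw [laguerrePoly_coeff_of_le _ hik, hc, show μ + j + i + 1 = μ + 1 + i + j by ring,
      Real.Gamma_add_natCast_eq_mul_ascPochhammer hpos, Nat.cast_choose ℝ hik]
    field_simp
  rw [h4, h2, h3]
  split_ifs
  · field_simp
  · simp

theorem integral_laguerrePoly_mul_laguerrePoly_of_le {μ : ℝ} (hμ : -1 < μ) {k m : ℕ}
    (h : m ≤ k) :
    ∫ u in Ioi (0 : ℝ), (laguerrePoly μ k).eval u * (laguerrePoly μ m).eval u *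
        (u ^ μ * Real.exp (-u)) =
      if k = m then Real.Gamma (k + μ + 1) / k.factorial else 0 := by
  have h1 : ∀ u : ℝ, (laguerrePoly μ k).eval u * (laguerrePoly μ m).eval u *
        (u ^ μ * Real.exp (-u)) = ∑ j ∈ Finset.range (m + 1), (laguerrePoly μ m).coeff j *
        (u ^ j * (laguerrePoly μ k).eval u * (u ^ μ * Real.exp (-u))) := by
    intro u
    rw [Polynomial.eval_eq_sum_range' (laguerrePoly_natDegree_lt μ m), Finset.mul_sum,
      Finset.sum_mul]
    exact Finset.sum_congr rfl fun j _ => by ring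
  simp_rw [h1]
  rw [integral_finsetSum]
  · simp_rw [integral_const_mul]
    rw [Finset.sum_congr rfl fun j hj => by
      rw [integral_pow_mul_laguerrePoly hμ
        ((Nat.lt_succ_iff.1 (Finset.mem_range.1 hj)).trans h)]]
    simp only [mul_ite, mul_zero, Finset.sum_ite_eq', Finset.mem_range]
    rcases h.eq_or_lt with rfl | h
    · rw [if_pos (by omega), if_pos rfl, laguerrePoly_coeff_of_le _ le_rfl]
      have : ((-1 : ℝ) ^ m) * (-1) ^ m = 1 := by rw [← mul_pow]; simp
      simp only [Nat.sub_self, Ring.choose_zero_right]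
      linear_combination (Real.Gamma (m + μ + 1) / m.factorial) * this
    · rw [if_neg (by omega), if_neg (by omega)]
  · intro j _
    refine Integrable.const_mul ?_ _
    have h2 := integrableOn_eval_mul_rpow_mul_exp_neg (Polynomial.X ^ j * laguerrePoly μ k) hμ
    have h3 : ∀ u : ℝ, (Polynomial.X ^ j * laguerrePoly μ k).eval u =
      u ^ j * (laguerrePoly μ k).eval u := fun u => by
        rw [Polynomial.eval_mul, Polynomial.eval_pow, Polynomial.eval_X]
    simp_rw [h3] at h2
    exact h2

theorem integral_laguerrePoly_mul_laguerrePoly {μ : ℝ} (hμ : -1 < μ) (k m : ℕ) :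
    ∫ u in Ioi (0 : ℝ), (laguerrePoly μ k).eval u * (laguerrePoly μ m).eval u *
        (u ^ μ * Real.exp (-u)) =
      if k = m then Real.Gamma (k + μ + 1) / k.factorial else 0 := by
  rcases le_total m k with h | h
  · exact integral_laguerrePoly_mul_laguerrePoly_of_le hμ h
  · simp_rw [mul_comm ((laguerrePoly μ k).eval _)]
    rw [integral_laguerrePoly_mul_laguerrePoly_of_le hμ h]
    by_cases hkm : k = m
    · subst hkm; rfl
    · rw [if_neg hkm, if_neg (Ne.symm hkm)]

/-! ### Gaussian integrals of polynomials over the plane -/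

open Polynomial

theorem Complex.integral_norm_pow_mul_exp_neg {c : ℝ} (hc : 0 < c) (n : ℕ) :
    ∫ w : ℂ, ‖w‖ ^ n * Real.exp (-‖w‖ ^ 2 / c) =
      Real.pi * (1 / c) ^ (-((n : ℝ) + 2) / 2) * Real.Gamma (((n : ℝ) + 2) / 2) := by
  have h := Complex.integral_rpow_mul_exp_neg_mul_rpow (p := 2) (q := n) (b := 1 / c)
    (by norm_num) (by have := n.cast_nonneg (α := ℝ); linarith) (by positivity)
  rw [show (2 * Real.pi / 2) = Real.pi by ring] at h
  rw [← h]
  refine integral_congr_ae (.of_forall fun w => ?_)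
  beta_reduce
  rw [Real.rpow_natCast, Real.rpow_two]
  congr 2
  ring

theorem Complex.integrable_norm_pow_mul_exp_neg {c : ℝ} (hc : 0 < c) (n : ℕ) :
    Integrable fun w : ℂ => ‖w‖ ^ n * Real.exp (-‖w‖ ^ 2 / c) := by
  -- The Bochner integral of a non-integrable function is `0`, so a nonzero value proves
  -- integrability.
  refine .of_integral_ne_zero ?_
  rw [Complex.integral_norm_pow_mul_exp_neg hc]
  have := Real.Gamma_pos_of_pos (show 0 < ((n : ℝ) + 2) / 2 by positivity)
  have := Real.pi_pos
  positivity

theorem Complex.integrable_pow_mul_conj_pow_mul_exp_neg {c : ℝ} (hc : 0 < c) (a b : ℕ) :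
    Integrable fun w : ℂ =>
      w ^ a * (starRingEnd ℂ) w ^ b * (Real.exp (-‖w‖ ^ 2 / c) : ℂ) := by
  refine (Complex.integrable_norm_pow_mul_exp_neg hc (a + b)).mono' ?_ (.of_forall fun w => ?_)
  · exact Continuous.aestronglyMeasurable (by fun_prop)
  · rw [norm_mul, norm_mul, norm_pow, norm_pow, RCLike.norm_conj, Complex.norm_real,
      Real.norm_of_nonneg (Real.exp_pos _).le, pow_add]

theorem Complex.integral_pow_mul_conj_pow_mul_exp_neg {c : ℝ} (hc : 0 < c) (a b : ℕ) :
    ∫ w : ℂ, w ^ a * (starRingEnd ℂ) w ^ b * (Real.exp (-‖w‖ ^ 2 / c) : ℂ) =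
      if a = b then ((Real.pi * c ^ (a + 1) * a.factorial : ℝ) : ℂ) else 0 := by
  split_ifs with h
  · subst h
    have h1 : ∀ w : ℂ, w ^ a * (starRingEnd ℂ) w ^ a * (Real.exp (-‖w‖ ^ 2 / c) : ℂ) =
        ((‖w‖ ^ (2 * a) * Real.exp (-‖w‖ ^ 2 / c) : ℝ) : ℂ) := by
      intro w
      rw [← mul_pow, Complex.mul_conj, Complex.normSq_eq_norm_sq]
      push_cast
      rw [← pow_mul]
    simp_rw [h1]
    rw [integral_complex_ofReal, Complex.integral_norm_pow_mul_exp_neg hc]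
    congr 1
    rw [show (((2 * a : ℕ) : ℝ) + 2) / 2 = (a : ℝ) + 1 by push_cast; ring,
      Real.Gamma_nat_eq_factorial,
      show -(((2 * a : ℕ) : ℝ) + 2) / 2 = -((a + 1 : ℕ) : ℝ) by push_cast; ring,
      Real.rpow_neg (by positivity), Real.rpow_natCast]
    simp
  -- Rotation by `ω` multiplies the integral by `ω ^ a * conj ω ^ b`. One radian makes this factor
  -- differ from `1` for all `a ≠ b`, because `π` is irrational.
  · obtain ⟨ω, hω⟩ : ∃ ω : Circle, (ω : ℂ) ^ a * (starRingEnd ℂ) (ω : ℂ) ^ b ≠ 1 := by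
      refine ⟨Circle.exp 1, fun h1 => ?_⟩
      rw [← Circle.coe_inv_eq_conj, ← Circle.exp_neg, Circle.coe_exp, Circle.coe_exp,
        ← Complex.exp_nat_mul, ← Complex.exp_nat_mul, ← Complex.exp_add,
        Complex.exp_eq_one_iff] at h1
      obtain ⟨n, hn⟩ := h1
      have hn' : ((a : ℝ) - b) = n * (2 * Real.pi) := by
        have := congrArg Complex.im hn
        simpa [sub_eq_add_neg] using this
      have hab : ((a : ℝ) - b) ≠ 0 := sub_ne_zero.2 (by exact_mod_cast h)
      have hn0 : (n : ℝ) ≠ 0 := by rintro h0; rw [h0] at hn'; simp at hn'; exact hab hn'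
      refine irrational_pi ⟨((a : ℚ) - b) / (n * 2), ?_⟩
      push_cast
      rw [hn']
      field_simp
    have hI := (rotation ω).measurePreserving.integral_comp
      (rotation ω).toHomeomorph.measurableEmbedding
      (fun w : ℂ => w ^ a * (starRingEnd ℂ) w ^ b * (Real.exp (-‖w‖ ^ 2 / c) : ℂ))
    simp only [rotation_apply, norm_mul, Circle.norm_coe, one_mul, map_mul, mul_pow] at hI
    have h2 : ∀ w : ℂ, (ω : ℂ) ^ a * w ^ a *
        ((starRingEnd ℂ) (ω : ℂ) ^ b * (starRingEnd ℂ) w ^ b) * (Real.exp (-‖w‖ ^ 2 / c) : ℂ) =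
        ((ω : ℂ) ^ a * (starRingEnd ℂ) (ω : ℂ) ^ b) *
        (w ^ a * (starRingEnd ℂ) w ^ b * (Real.exp (-‖w‖ ^ 2 / c) : ℂ)) := fun w => by ring
    simp_rw [h2] at hI
    rw [integral_const_mul] at hI
    by_contra hne
    exact hω (mul_right_cancel₀ hne (hI.trans (one_mul _).symm))

theorem Complex.aeval_mul_conj_aeval_eq_sum {p q : ℝ[X]} {N : ℕ} (hp : p.natDegree < N)
    (hq : q.natDegree < N) (w : ℂ) :
    aeval w p * (starRingEnd ℂ) (aeval w q) = ∑ i ∈ Finset.range N, ∑ j ∈ Finset.range N,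
      ((p.coeff i * q.coeff j : ℝ) : ℂ) * (w ^ i * (starRingEnd ℂ) w ^ j) := by
  rw [aeval_eq_sum_range' hp, aeval_eq_sum_range' hq, map_sum, Finset.sum_mul_sum]
  refine Finset.sum_congr rfl fun i _ => Finset.sum_congr rfl fun j _ => ?_
  simp only [Complex.real_smul, map_mul, map_pow, Complex.conj_ofReal]
  push_cast
  ring

theorem Complex.integrable_aeval_mul_conj_aeval_mul_exp_neg {c : ℝ} (hc : 0 < c) (p q : ℝ[X]) :
    Integrable fun w : ℂ =>
      aeval w p * (starRingEnd ℂ) (aeval w q) * (Real.exp (-‖w‖ ^ 2 / c) : ℂ) := by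
  simp_rw [Complex.aeval_mul_conj_aeval_eq_sum
    (Nat.lt_succ_of_le (le_max_left p.natDegree q.natDegree))
    (Nat.lt_succ_of_le (le_max_right p.natDegree q.natDegree)), Finset.sum_mul, mul_assoc]
  refine integrable_finsetSum _ fun i _ => integrable_finsetSum _ fun j _ => ?_
  refine Integrable.const_mul ?_ _
  simpa only [mul_assoc] using Complex.integrable_pow_mul_conj_pow_mul_exp_neg hc i j

theorem Complex.integral_aeval_mul_conj_aeval_mul_exp_neg {c : ℝ} (hc : 0 < c) {p q : ℝ[X]}
    {N : ℕ} (hp : p.natDegree < N) (hq : q.natDegree < N) :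
    ∫ w : ℂ, aeval w p * (starRingEnd ℂ) (aeval w q) * (Real.exp (-‖w‖ ^ 2 / c) : ℂ) =
      ((∑ n ∈ Finset.range N, Real.pi * c ^ (n + 1) * n.factorial * (p.coeff n * q.coeff n) : ℝ)
        : ℂ) := by
  have hint : ∀ i j : ℕ, Integrable fun w : ℂ => ((p.coeff i * q.coeff j : ℝ) : ℂ) *
      (w ^ i * (starRingEnd ℂ) w ^ j * (Real.exp (-‖w‖ ^ 2 / c) : ℂ)) := fun i j =>
    (Complex.integrable_pow_mul_conj_pow_mul_exp_neg hc i j).const_mul _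
  have h1 : ∀ w : ℂ, aeval w p * (starRingEnd ℂ) (aeval w q) * (Real.exp (-‖w‖ ^ 2 / c) : ℂ) =
      ∑ i ∈ Finset.range N, ∑ j ∈ Finset.range N, ((p.coeff i * q.coeff j : ℝ) : ℂ) *
      (w ^ i * (starRingEnd ℂ) w ^ j * (Real.exp (-‖w‖ ^ 2 / c) : ℂ)) := fun w => by
    simp_rw [Complex.aeval_mul_conj_aeval_eq_sum hp hq, Finset.sum_mul, mul_assoc]
  simp_rw [h1]
  rw [integral_finsetSum _ fun i _ => integrable_finsetSum _ fun j _ => hint i j,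
    Complex.ofReal_sum]
  refine Finset.sum_congr rfl fun i hi => ?_
  rw [integral_finsetSum _ fun j _ => hint i j]
  simp_rw [integral_const_mul, Complex.integral_pow_mul_conj_pow_mul_exp_neg hc, mul_ite, mul_zero]
  rw [Finset.sum_ite_eq, if_pos hi, ← Complex.ofReal_mul]
  congr 1
  ring

theorem Polynomial.aeval_add_ofReal_eq_aeval_taylor (p : ℝ[X]) (u : ℝ) (w : ℂ) :
    aeval (w + u) p = aeval w (taylor u p) := by
  rw [taylor_apply, aeval_comp]
  simp

theorem Complex.integrable_aeval_mul_conj_aeval_mul_exp_neg_sub {c : ℝ} (hc : 0 < c)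
    (p q : ℝ[X]) (u : ℝ) :
    Integrable fun z : ℂ =>
      aeval z p * (starRingEnd ℂ) (aeval z q) * (Real.exp (-‖z - u‖ ^ 2 / c) : ℂ) := by
  have h := (Complex.integrable_aeval_mul_conj_aeval_mul_exp_neg hc (taylor u p)
    (taylor u q)).comp_sub_right (u : ℂ)
  simpa only [← aeval_add_ofReal_eq_aeval_taylor, sub_add_cancel] using h

/-- Translating by `u` centres the Gaussian and replaces coefficients by Taylor coefficients at `u`.
-/
theorem Complex.integral_aeval_mul_conj_aeval_mul_exp_neg_sub {c : ℝ} (hc : 0 < c) {p q : ℝ[X]}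
    {N : ℕ} (hp : p.natDegree < N) (hq : q.natDegree < N) (u : ℝ) :
    ∫ z : ℂ, aeval z p * (starRingEnd ℂ) (aeval z q) * (Real.exp (-‖z - u‖ ^ 2 / c) : ℂ) =
      ((∑ n ∈ Finset.range N, Real.pi * c ^ (n + 1) * n.factorial *
        ((hasseDeriv n p).eval u * (hasseDeriv n q).eval u) : ℝ) : ℂ) := by
  rw [← integral_add_right_eq_self _ (u : ℂ)]
  simp only [add_sub_cancel_right, aeval_add_ofReal_eq_aeval_taylor]
  rw [Complex.integral_aeval_mul_conj_aeval_mul_exp_neg hc (N := N) (by rwa [natDegree_taylor])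
    (by rwa [natDegree_taylor])]
  simp only [taylor_coeff]

/-! ### The weight as a mixture of Gaussians -/

/-- The integrand of the representation of `laguerreWeight ν θ z` as a mixture over `u > 0` of
Gaussian densities in `z` with centre `u` and variance proportional to `u`. -/
noncomputable def laguerreKernel (ν θ : ℝ) (z : ℂ) (u : ℝ) : ℝ :=
  u ^ (ν - 1) * Real.exp (-u) * Real.exp (-‖z - u‖ ^ 2 / ((θ - 1) * u))

theorem laguerreKernel_nonneg (ν θ : ℝ) (z : ℂ) {u : ℝ} (hu : 0 < u) :
    0 ≤ laguerreKernel ν θ z u := by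
  unfold laguerreKernel
  positivity

theorem measurable_laguerreKernel (ν θ : ℝ) :
    Measurable fun x : ℂ × ℝ => laguerreKernel ν θ x.1 x.2 := by
  unfold laguerreKernel
  fun_prop

theorem macdonaldK_eq_integral_exp {ν x : ℝ}
    (h : Integrable fun t : ℝ => Real.exp (-x * Real.cosh t + ν * t)) :
    macdonaldK ν x = (∫ t : ℝ, Real.exp (-x * Real.cosh t + ν * t)) / 2 := by
  have h1 := integral_comp_abs (f := fun t => Real.exp (-x * Real.cosh t) * Real.cosh (ν * t))
  have h2 : ∀ t : ℝ, Real.exp (-x * Real.cosh |t|) * Real.cosh (ν * |t|) =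
      (Real.exp (-x * Real.cosh t + ν * t) + Real.exp (-x * Real.cosh (-t) + ν * (-t))) / 2 := by
    intro t
    have : Real.cosh (ν * |t|) = Real.cosh (ν * t) := by
      rw [← Real.cosh_abs, abs_mul, abs_abs, ← abs_mul, Real.cosh_abs]
    rw [Real.cosh_abs, this, Real.cosh_eq (ν * t), Real.exp_add, Real.exp_add, Real.cosh_neg,
      mul_neg]
    ring
  simp_rw [h2] at h1
  rw [integral_div, integral_add h h.comp_neg,
    integral_neg_eq_self (fun t : ℝ => Real.exp (-x * Real.cosh t + ν * t))] at h1
  unfold macdonaldK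
  linarith

theorem image_mul_exp_univ {r : ℝ} (hr : 0 < r) :
    (fun t : ℝ => r * Real.exp t) '' univ = Ioi 0 := by
  rw [image_univ, show (fun t : ℝ => r * Real.exp t) = (fun y => r * y) ∘ Real.exp from rfl,
    range_comp, Real.range_exp, image_mul_left_Ioi hr, mul_zero]

/-- The exponent of the kernel is `(2 * z.re - ‖z‖ ^ 2 / u - θ * u) / (θ - 1)`. The choice `u = (‖z‖
/ √θ) * exp t` balances the last two terms into a `cosh`. -/
theorem mul_exp_mul_laguerreKernel {ν θ : ℝ} (hθ : 1 < θ) {z : ℂ} (hz : z ≠ 0) (t : ℝ) :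
    |‖z‖ / √θ * Real.exp t| • laguerreKernel ν θ z (‖z‖ / √θ * Real.exp t) =
      (‖z‖ / √θ) ^ ν * Real.exp (2 * z.re / (θ - 1)) *
        Real.exp (-(2 * √θ * ‖z‖ / (θ - 1)) * Real.cosh t + ν * t) := by
  have hθ1 : 0 < θ - 1 := by linarith
  have hs : 0 < √θ := Real.sqrt_pos.2 (by linarith)
  have hs2 : √θ ^ 2 = θ := Real.sq_sqrt (by linarith)
  have hz' : 0 < ‖z‖ := norm_pos_iff.2 hz
  set r := ‖z‖ / √θ with hr
  have hr0 : 0 < r := by positivity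
  have hzr : ‖z‖ = √θ * r := by rw [hr]; field_simp
  have hu : 0 < r * Real.exp t := by positivity
  have hnorm : ‖z - (r * Real.exp t : ℝ)‖ ^ 2 =
      θ * r ^ 2 - 2 * (r * Real.exp t) * z.re + (r * Real.exp t) ^ 2 := by
    have h1 : ‖z‖ ^ 2 = θ * r ^ 2 := by rw [hzr, mul_pow, hs2]
    rw [← h1, ← Complex.normSq_eq_norm_sq, ← Complex.normSq_eq_norm_sq, Complex.normSq_apply,
      Complex.normSq_apply]
    simp only [Complex.sub_re, Complex.sub_im, Complex.ofReal_re, Complex.ofReal_im]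
    ring
  unfold laguerreKernel
  rw [hnorm, abs_of_pos hu, smul_eq_mul, Real.rpow_sub_one hu.ne',
    Real.mul_rpow hr0.le (Real.exp_pos t).le, ← Real.exp_mul]
  have h3 : r * Real.exp t * (r ^ ν * Real.exp (t * ν) / (r * Real.exp t) *
      Real.exp (-(r * Real.exp t)) *
      Real.exp (-(θ * r ^ 2 - 2 * (r * Real.exp t) * z.re + (r * Real.exp t) ^ 2) /
        ((θ - 1) * (r * Real.exp t)))) =
      r ^ ν * (Real.exp (t * ν) * Real.exp (-(r * Real.exp t)) *
      Real.exp (-(θ * r ^ 2 - 2 * (r * Real.exp t) * z.re + (r * Real.exp t) ^ 2) /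
        ((θ - 1) * (r * Real.exp t)))) := by
    field_simp
  rw [h3, mul_assoc (r ^ ν), ← Real.exp_add, ← Real.exp_add, ← Real.exp_add]
  congr 2
  have h4 : 2 * √θ * ‖z‖ = 2 * θ * r := by rw [hzr]; linear_combination (2 * r) * hs2
  rw [h4, Real.cosh_eq, Real.exp_neg]
  have := (Real.exp_pos t).ne'
  field_simp
  ring

theorem laguerreWeight_eq_integral_laguerreKernel {ν θ : ℝ} (hθ : 1 < θ) {z : ℂ} (hz : z ≠ 0)
    (h : IntegrableOn (laguerreKernel ν θ z) (Ioi 0)) :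
    laguerreWeight ν θ z = θ ^ (ν / 2) / 2 * ∫ u in Ioi (0 : ℝ), laguerreKernel ν θ z u := by
  have hs : 0 < √θ := Real.sqrt_pos.2 (by linarith)
  have hz' : 0 < ‖z‖ := norm_pos_iff.2 hz
  have hr : 0 < ‖z‖ / √θ := by positivity
  have hder : ∀ t ∈ (univ : Set ℝ), HasDerivWithinAt (fun t : ℝ => ‖z‖ / √θ * Real.exp t)
      (‖z‖ / √θ * Real.exp t) univ t := fun t _ =>
    ((Real.hasDerivAt_exp t).const_mul _).hasDerivWithinAt
  have hinj : InjOn (fun t : ℝ => ‖z‖ / √θ * Real.exp t) univ := fun a _ b _ hab =>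
    Real.exp_injective (mul_left_cancel₀ hr.ne' hab)
  have hint := integral_image_eq_integral_abs_deriv_smul MeasurableSet.univ hder hinj
    (laguerreKernel ν θ z)
  rw [← image_mul_exp_univ hr, integrableOn_image_iff_integrableOn_abs_deriv_smul
    MeasurableSet.univ hder hinj] at h
  simp only [mul_exp_mul_laguerreKernel hθ hz] at h hint
  have hc : (‖z‖ / √θ) ^ ν * Real.exp (2 * z.re / (θ - 1)) ≠ 0 := by positivity
  rw [integrableOn_univ, integrable_const_mul_iff (IsUnit.mk0 _ hc)] at h
  rw [image_mul_exp_univ hr, setIntegral_univ, integral_const_mul] at hint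
  rw [hint, laguerreWeight, macdonaldK_eq_integral_exp h, Real.div_rpow hz'.le hs.le,
    Real.sqrt_eq_rpow, ← Real.rpow_mul (by linarith), show 1 / 2 * ν = ν / 2 by ring]
  have : θ ^ (ν / 2) ≠ 0 := (Real.rpow_pos_of_pos (by linarith) _).ne'
  field_simp

/-! ### Fubini for the mixture -/

theorem integrable_aeval_mul_conj_aeval_mul_laguerreKernel {ν θ : ℝ} (hθ : 1 < θ) (p q : ℝ[X])
    {u : ℝ} (hu : 0 < u) :
    Integrable fun z : ℂ =>
      aeval z p * (starRingEnd ℂ) (aeval z q) * (laguerreKernel ν θ z u : ℂ) := by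
  have h := (Complex.integrable_aeval_mul_conj_aeval_mul_exp_neg_sub
    (mul_pos (sub_pos.2 hθ) hu) p q u).const_mul ((u ^ (ν - 1) * Real.exp (-u) : ℝ) : ℂ)
  refine h.congr (.of_forall fun z => ?_)
  simp only [laguerreKernel]
  push_cast
  ring

theorem integral_aeval_mul_conj_aeval_mul_laguerreKernel {ν θ : ℝ} (hθ : 1 < θ) {p q : ℝ[X]}
    {N : ℕ} (hp : p.natDegree < N) (hq : q.natDegree < N) {u : ℝ} (hu : 0 < u) :
    ∫ z : ℂ, aeval z p * (starRingEnd ℂ) (aeval z q) * (laguerreKernel ν θ z u : ℂ) =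
      ((∑ n ∈ Finset.range N, Real.pi * (θ - 1) ^ (n + 1) * n.factorial *
        ((hasseDeriv n p).eval u * (hasseDeriv n q).eval u * (u ^ (ν + n) * Real.exp (-u))) : ℝ)
        : ℂ) := by
  have h1 : ∀ z : ℂ, aeval z p * (starRingEnd ℂ) (aeval z q) * (laguerreKernel ν θ z u : ℂ) =
      ((u ^ (ν - 1) * Real.exp (-u) : ℝ) : ℂ) * (aeval z p * (starRingEnd ℂ) (aeval z q) *
        (Real.exp (-‖z - u‖ ^ 2 / ((θ - 1) * u)) : ℂ)) := by
    intro z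
    simp only [laguerreKernel]
    push_cast
    ring
  simp_rw [h1]
  rw [integral_const_mul, Complex.integral_aeval_mul_conj_aeval_mul_exp_neg_sub
    (mul_pos (sub_pos.2 hθ) hu) hp hq, ← Complex.ofReal_mul, Finset.mul_sum]
  congr 1
  refine Finset.sum_congr rfl fun n _ => ?_
  -- The variance `(θ - 1) * u` contributes `u ^ (n + 1)`, which raises the exponent `ν - 1` to `ν +
  -- n`.
  have : u ^ (ν + n) = u ^ (ν - 1) * u ^ (n + 1) := by
    rw [← Real.rpow_add_natCast hu.ne']
    push_cast
    ring_nf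
  rw [this, mul_pow]
  ring

theorem integrable_hasseDeriv_mul_hasseDeriv {ν : ℝ} (hν : -1 < ν) (p q : ℝ[X]) (n : ℕ) :
    IntegrableOn (fun u : ℝ => (hasseDeriv n p).eval u * (hasseDeriv n q).eval u *
      (u ^ (ν + n) * Real.exp (-u))) (Ioi 0) := by
  have h := integrableOn_eval_mul_rpow_mul_exp_neg (hasseDeriv n p * hasseDeriv n q)
    (show -1 < ν + n by have := n.cast_nonneg (α := ℝ); linarith)
  simpa only [eval_mul] using h

theorem aestronglyMeasurable_aeval_mul_conj_aeval_mul_laguerreKernel (ν θ : ℝ) (p q : ℝ[X]) :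
    AEStronglyMeasurable (fun x : ℂ × ℝ => aeval x.1 p * (starRingEnd ℂ) (aeval x.1 q) *
      (laguerreKernel ν θ x.1 x.2 : ℂ)) (volume.prod (volume.restrict (Ioi 0))) := by
  have h1 : Measurable fun x : ℂ × ℝ => aeval x.1 p * (starRingEnd ℂ) (aeval x.1 q) :=
    Continuous.measurable (by fun_prop)
  exact (h1.mul (measurable_laguerreKernel ν θ).complex_ofReal).aestronglyMeasurable

/-- For `p = q` the integrand is nonnegative, so the `z`-integral of its norm is the explicit sum
already computed, and Tonelli applies. -/
theorem integrable_prod_aeval_mul_conj_self_mul_laguerreKernel {ν θ : ℝ} (hν : -1 < ν)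
    (hθ : 1 < θ) (p : ℝ[X]) :
    Integrable (fun x : ℂ × ℝ => aeval x.1 p * (starRingEnd ℂ) (aeval x.1 p) *
      (laguerreKernel ν θ x.1 x.2 : ℂ)) (volume.prod (volume.restrict (Ioi 0))) := by
  rw [integrable_prod_iff' (aestronglyMeasurable_aeval_mul_conj_aeval_mul_laguerreKernel ν θ p p)]
  refine ⟨(ae_restrict_mem measurableSet_Ioi).mono fun u hu =>
    integrable_aeval_mul_conj_aeval_mul_laguerreKernel hθ p p hu, ?_⟩
  have h : IntegrableOn (fun u : ℝ => ∑ n ∈ Finset.range (p.natDegree + 1),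
      Real.pi * (θ - 1) ^ (n + 1) * n.factorial * ((hasseDeriv n p).eval u *
        (hasseDeriv n p).eval u * (u ^ (ν + n) * Real.exp (-u)))) (Ioi 0) :=
    integrable_finsetSum _ fun n _ => (integrable_hasseDeriv_mul_hasseDeriv hν p p n).const_mul _
  refine IntegrableOn.congr_fun h (fun u hu => ?_) measurableSet_Ioi
  have h1 := integral_aeval_mul_conj_aeval_mul_laguerreKernel (ν := ν) hθ
    p.natDegree.lt_succ_self p.natDegree.lt_succ_self hu
  rw [← Complex.ofReal_inj, ← h1, ← integral_complex_ofReal]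
  refine integral_congr_ae (.of_forall fun z => ?_)
  simp only [norm_mul, RCLike.norm_conj, Complex.norm_real,
    Real.norm_of_nonneg (laguerreKernel_nonneg ν θ z hu)]
  rw [Complex.mul_conj, Complex.normSq_eq_norm_sq]
  push_cast
  ring

theorem integrable_prod_aeval_mul_conj_aeval_mul_laguerreKernel {ν θ : ℝ} (hν : -1 < ν)
    (hθ : 1 < θ) (p q : ℝ[X]) :
    Integrable (fun x : ℂ × ℝ => aeval x.1 p * (starRingEnd ℂ) (aeval x.1 q) *
      (laguerreKernel ν θ x.1 x.2 : ℂ)) (volume.prod (volume.restrict (Ioi 0))) := by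
  refine ((integrable_prod_aeval_mul_conj_self_mul_laguerreKernel hν hθ p).norm.add
    (integrable_prod_aeval_mul_conj_self_mul_laguerreKernel hν hθ q).norm).mono'
    (aestronglyMeasurable_aeval_mul_conj_aeval_mul_laguerreKernel ν θ p q)
    (.of_forall fun x => ?_)
  simp only [Pi.add_apply, norm_mul, RCLike.norm_conj]
  rw [← add_mul]
  refine mul_le_mul_of_nonneg_right ?_ (norm_nonneg _)
  nlinarith [sq_nonneg (‖aeval x.1 p‖ - ‖aeval x.1 q‖), sq_nonneg ‖aeval x.1 p‖,
    sq_nonneg ‖aeval x.1 q‖]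

/-- Product integrability with `p = 1` supplies convergence of the `u`-integral for almost every
`z`. -/
theorem laguerreWeight_ae_eq {ν θ : ℝ} (hν : -1 < ν) (hθ : 1 < θ) :
    ∀ᵐ z : ℂ, laguerreWeight ν θ z =
      θ ^ (ν / 2) / 2 * ∫ u in Ioi (0 : ℝ), laguerreKernel ν θ z u := by
  have h := (integrable_prod_aeval_mul_conj_self_mul_laguerreKernel hν hθ 1).prod_right_ae
  filter_upwards [h, Measure.ae_ne volume (0 : ℂ)] with z hz hz0
  refine laguerreWeight_eq_integral_laguerreKernel hθ hz0 ?_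
  simpa [IntegrableOn] using hz.re

theorem aeval_mul_conj_aeval_mul_laguerreWeight_ae_eq {ν θ : ℝ} (hν : -1 < ν) (hθ : 1 < θ)
    (p q : ℝ[X]) :
    (fun z : ℂ => aeval z p * (starRingEnd ℂ) (aeval z q) * (laguerreWeight ν θ z : ℂ)) =ᵐ[volume]
      fun z : ℂ => ((θ ^ (ν / 2) / 2 : ℝ) : ℂ) * ∫ u in Ioi (0 : ℝ),
        aeval z p * (starRingEnd ℂ) (aeval z q) * (laguerreKernel ν θ z u : ℂ) := by
  filter_upwards [laguerreWeight_ae_eq hν hθ] with z hz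
  rw [hz, integral_const_mul, integral_complex_ofReal]
  push_cast
  ring

theorem integrable_aeval_mul_conj_aeval_mul_laguerreWeight {ν θ : ℝ} (hν : -1 < ν) (hθ : 1 < θ)
    (p q : ℝ[X]) :
    Integrable fun z : ℂ =>
      aeval z p * (starRingEnd ℂ) (aeval z q) * (laguerreWeight ν θ z : ℂ) :=
  ((integrable_prod_aeval_mul_conj_aeval_mul_laguerreKernel hν hθ p q).integral_prod_left.const_mul
    _).congr (aeval_mul_conj_aeval_mul_laguerreWeight_ae_eq hν hθ p q).symm

theorem integral_aeval_mul_conj_aeval_mul_laguerreWeight {ν θ : ℝ} (hν : -1 < ν) (hθ : 1 < θ)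
    {p q : ℝ[X]} {N : ℕ} (hp : p.natDegree < N) (hq : q.natDegree < N) :
    ((2 * θ ^ (-ν / 2) / (Real.pi * (θ - 1)) : ℝ) : ℂ) *
      ∫ z : ℂ, aeval z p * (starRingEnd ℂ) (aeval z q) * (laguerreWeight ν θ z : ℂ) =
      ((∑ n ∈ Finset.range N, (θ - 1) ^ n * n.factorial * ∫ u in Ioi (0 : ℝ),
        (hasseDeriv n p).eval u * (hasseDeriv n q).eval u * (u ^ (ν + n) * Real.exp (-u)) : ℝ)
        : ℂ) := by
  rw [integral_congr_ae (aeval_mul_conj_aeval_mul_laguerreWeight_ae_eq hν hθ p q),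
    integral_const_mul, integral_integral_swap
      (f := fun (z : ℂ) (u : ℝ) =>
        aeval z p * (starRingEnd ℂ) (aeval z q) * (laguerreKernel ν θ z u : ℂ))
      (integrable_prod_aeval_mul_conj_aeval_mul_laguerreKernel hν hθ p q),
    setIntegral_congr_fun measurableSet_Ioi fun u hu =>
      integral_aeval_mul_conj_aeval_mul_laguerreKernel hθ hp hq hu,
    integral_complex_ofReal, integral_finsetSum _ fun n _ =>
      (integrable_hasseDeriv_mul_hasseDeriv hν p q n).const_mul _,
    ← Complex.ofReal_mul, ← Complex.ofReal_mul]
  congr 1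
  have hθ0 : 0 < θ := by linarith
  have hθ1 : θ - 1 ≠ 0 := by linarith
  have hπ := Real.pi_ne_zero
  have h1 : θ ^ (-ν / 2) * θ ^ (ν / 2) = 1 := by
    rw [← Real.rpow_add hθ0, show -ν / 2 + ν / 2 = 0 by ring, Real.rpow_zero]
  have h2 : ∀ S : ℝ, 2 * θ ^ (-ν / 2) / (Real.pi * (θ - 1)) * (θ ^ (ν / 2) / 2 * S) =
      S / (Real.pi * (θ - 1)) := fun S => by
    linear_combination (S / (Real.pi * (θ - 1))) * h1
  rw [h2, Finset.sum_div]
  refine Finset.sum_congr rfl fun n _ => ?_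
  rw [integral_const_mul, pow_succ]
  field_simp

/-! ### Orthogonality of the derivatives and conclusion -/

theorem integral_hasseDeriv_laguerrePoly_mul {ν : ℝ} (hν : -1 < ν) {k m n : ℕ} (hk : n ≤ k)
    (hm : n ≤ m) :
    ∫ u in Ioi (0 : ℝ), (hasseDeriv n (laguerrePoly ν k)).eval u *
      (hasseDeriv n (laguerrePoly ν m)).eval u * (u ^ (ν + n) * Real.exp (-u)) =
      if k = m then
        Real.Gamma (k + ν + 1) / ((n.factorial : ℝ) ^ 2 * (k - n).factorial) else 0 := by
  rw [hasseDeriv_laguerrePoly ν hk, hasseDeriv_laguerrePoly ν hm]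
  have h1 : ∀ u : ℝ, (C ((-1) ^ n / (n.factorial : ℝ)) * laguerrePoly (ν + n) (k - n)).eval u *
      (C ((-1) ^ n / (n.factorial : ℝ)) * laguerrePoly (ν + n) (m - n)).eval u *
        (u ^ (ν + n) * Real.exp (-u)) = (1 / (n.factorial : ℝ) ^ 2) *
      ((laguerrePoly (ν + n) (k - n)).eval u * (laguerrePoly (ν + n) (m - n)).eval u *
        (u ^ (ν + n) * Real.exp (-u))) := by
    intro u
    have : ((-1 : ℝ) ^ n) * (-1) ^ n = 1 := by rw [← mul_pow]; simp
    rw [eval_mul, eval_mul, eval_C]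
    linear_combination ((1 / (n.factorial : ℝ) ^ 2) * ((laguerrePoly (ν + n) (k - n)).eval u *
      (laguerrePoly (ν + n) (m - n)).eval u * (u ^ (ν + n) * Real.exp (-u)))) * this
  simp_rw [h1]
  rw [integral_const_mul, integral_laguerrePoly_mul_laguerrePoly
    (by have := n.cast_nonneg (α := ℝ); linarith)]
  by_cases h : k = m
  · rw [if_pos h, if_pos (by omega), Nat.cast_sub hk,
      show (k : ℝ) - n + (ν + n) + 1 = k + ν + 1 by ring]
    field_simp
  · rw [if_neg h, if_neg (by omega), mul_zero]

theorem mainTheorem5 (ν θ : ℝ) (hν : -1 < ν) (hθ : 1 < θ) (k m : ℕ) :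
    MeasureTheory.Integrable
      (fun z : ℂ => Polynomial.aeval z (laguerrePoly ν k) *
        (starRingEnd ℂ) (Polynomial.aeval z (laguerrePoly ν m)) * (laguerreWeight ν θ z : ℂ))
      MeasureTheory.volume ∧
    ((2 * θ ^ (-ν / 2) / (Real.pi * (θ - 1)) : ℝ) : ℂ) *
      ∫ z : ℂ, Polynomial.aeval z (laguerrePoly ν k) *
        (starRingEnd ℂ) (Polynomial.aeval z (laguerrePoly ν m)) * (laguerreWeight ν θ z : ℂ) =
      if k = m then
        ((Real.Gamma ((k : ℝ) + ν + 1) * θ ^ k / (k.factorial : ℝ) : ℝ) : ℂ)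
      else 0 := by
  refine ⟨integrable_aeval_mul_conj_aeval_mul_laguerreWeight hν hθ _ _, ?_⟩
  split_ifs with h
  · subst h
    rw [integral_aeval_mul_conj_aeval_mul_laguerreWeight hν hθ (laguerrePoly_natDegree_lt ν k)
      (laguerrePoly_natDegree_lt ν k)]
    congr 1
    -- Binomial expansion of `((θ - 1) + 1) ^ k`, to be matched term by term with the derivative
    -- orders `n`.
    have h1 : θ ^ k = ∑ n ∈ Finset.range (k + 1), (θ - 1) ^ n * (k.choose n : ℝ) := by
      have := add_pow (θ - 1) 1 k
      simpa using this
    rw [h1, Finset.mul_sum, Finset.sum_div]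
    refine Finset.sum_congr rfl fun n hn => ?_
    have hnk : n ≤ k := Nat.lt_succ_iff.1 (Finset.mem_range.1 hn)
    rw [integral_hasseDeriv_laguerrePoly_mul hν hnk hnk, if_pos rfl, Nat.cast_choose ℝ hnk]
    field_simp
  · rw [integral_aeval_mul_conj_aeval_mul_laguerreWeight hν hθ (N := k + m + 1)
      ((laguerrePoly_natDegree_lt ν k).trans_le (by omega))
      ((laguerrePoly_natDegree_lt ν m).trans_le (by omega)), Finset.sum_eq_zero,
      Complex.ofReal_zero]
    intro n _
    by_cases hn : n ≤ k ∧ n ≤ m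
    · rw [integral_hasseDeriv_laguerrePoly_mul hν hn.1 hn.2, if_neg h, mul_zero]
    -- Here `n` exceeds one of the two degrees, so that derivative vanishes.
    · have h0 : hasseDeriv n (laguerrePoly ν k) = 0 ∨ hasseDeriv n (laguerrePoly ν m) = 0 := by
        have hk := laguerrePoly_natDegree_lt ν k
        have hm := laguerrePoly_natDegree_lt ν m
        by_cases hnk : n ≤ k
        · exact .inr (hasseDeriv_eq_zero_of_lt_natDegree _ _ (by omega))
        · exact .inl (hasseDeriv_eq_zero_of_lt_natDegree _ _ (by omega))
      rcases h0 with h0 | h0 <;> simp [h0]
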